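/- A quandle is a set $X$ with a binary operation $\lhd$ such that $x\lhd x=x$, each map $(\bullet\lhd y):X\to X$ is bijective, and $(x\lhd y)\lhd z=(x\lhd z)\lhd(y\lhd z)$. Its adjoint group is $$\mathrm{As}(X)=\langle\, e_x\ (x\in X)\ \mid\ e_{x\lhd y}^{-1}e_y^{-1}e_xe_y\ (x,y\in X)\,\rangle ,$$ which acts on $X$ from the right by $x\cdot e_y=x\lhd y$; $X$ is connected if this action has exactly one orbit. A quandle homomorphism $f:Y\to X$ induces the homomorphism $f_*:\mathrm{As}(Y)\to\mathrm{As}(X)$, $e_y\mapsto e_{f(y)}$. The quandle $X$ is of finite type $t_X$ (written $t_X<\infty$) if $t_X$ is the least integer $N>0$ such that $x\lhd^N y=x$ for all $x,y\in X$, where $\bullet\lhd^N y$ is the $N$-fold application of $\bullet\lhd y$. The quandle homology $H^Q_n(X)$ is the homology of $C^R_n(X)/C^D_n(X)$, where $C^R_n(X)$ is the free $\mathbb Z$-module on $X^n$ with boundary $$\partial_n(x_1,\dots,x_n)=\sum_{i=1}^n(-1)^i\bigl((x_1\lhd x_i,\dots,x_{i-1}\lhd x_i,x_{i+1},\dots,x_n)-(x_1,\dots,x_{i-1},x_{i+1},\dots,x_n)\bigr),$$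 and $C^D_n(X)$ is the subcomplex generated by the tuples with $x_i=x_{i+1}$ for some $i$. Let $X$ be a connected quandle, let $a\in X$, and let $\varepsilon:\mathrm{As}(X)\to\mathbb Z$ be the homomorphism with $\varepsilon(e_x)=1$ for all $x\in X$. The universal covering of $X$ is the map $p:\widetilde X\to X$, where $\widetilde X$ is the set $\mathrm{Ker}(\varepsilon)$ with the quandle operation $g\lhd h=e_a^{-1}gh^{-1}e_ah$, and $p(g)=a\cdot g$. **Theorem.** There is a group isomorphism $$H_2^Q(\widetilde X)\;\cong\;\mathrm{Ker}\bigl(p_*:\mathrm{As}(\widetilde X)\to\mathrm{As}(X)\bigr).$$ In particular, if $t_X<\infty$, then $H_2^Q(\widetilde X)$ is annihilated by $t_X$. -/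

import Mathlib

namespace NosakaQuandle

universe u v

/-- The quandle operation written on the right, `x ⊲ y`. Mathlib's quandles act from the left:
`x ⊲ y` is Mathlib's `Shelf.act y x`, so that `(• ⊲ y)` is bijective, `x ⊲ x = x` and
`(x ⊲ y) ⊲ z = (x ⊲ z) ⊲ (y ⊲ z)`. -/
def rop {X : Type u} [Shelf X] (x y : X) : X := Shelf.act y x

infixl:70 " ⊲ " => rop

theorem rop_self {X : Type u} [Quandle X] (x : X) : x ⊲ x = x := Quandle.fix

theorem rop_distrib {X : Type u} [Shelf X] (x y z : X) :
    (x ⊲ y) ⊲ z = (x ⊲ z) ⊲ (y ⊲ z) := Shelf.self_distrib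

/-! ### The adjoint group -/

/-- The relators `e_{x ⊲ y}⁻¹ e_y⁻¹ e_x e_y` of the adjoint group. -/
def asRels (X : Type u) [Quandle X] : Set (FreeGroup X) :=
  {r | ∃ x y : X, r = (FreeGroup.of (x ⊲ y))⁻¹ * (FreeGroup.of y)⁻¹ * FreeGroup.of x *
    FreeGroup.of y}

/-- The adjoint group `As(X) = ⟨ e_x (x ∈ X) | e_{x ⊲ y}⁻¹ e_y⁻¹ e_x e_y (x, y ∈ X) ⟩`.
(Mathlib's `Rack.EnvelGroup X` has the relations `e_{x ⊲ y} = e_y e_x e_y⁻¹`, that is, it is the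
opposite group.) -/
abbrev As (X : Type u) [Quandle X] : Type u := PresentedGroup (asRels X)

/-- The generator `e_x` of `As(X)`. -/
def e {X : Type u} [Quandle X] (x : X) : As X := PresentedGroup.of x

theorem e_rop {X : Type u} [Quandle X] (x y : X) : e (x ⊲ y) = (e y)⁻¹ * e x * e y := by
  have h : PresentedGroup.mk (asRels X) ((FreeGroup.of (x ⊲ y))⁻¹ * (FreeGroup.of y)⁻¹ *
      FreeGroup.of x * FreeGroup.of y) = 1 :=
    PresentedGroup.one_of_mem ⟨x, y, rfl⟩
  simp only [map_mul, map_inv] at h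
  change (e (x ⊲ y))⁻¹ * (e y)⁻¹ * e x * e y = 1 at h
  rw [mul_assoc, mul_assoc, inv_mul_eq_one] at h
  rw [h, mul_assoc]

/-- The homomorphism `As(X) → G` sending `e_x` to `f x`. -/
def As.lift {X : Type u} [Quandle X] {G : Type v} [Group G] (f : X → G)
    (hf : ∀ x y, f (x ⊲ y) = (f y)⁻¹ * f x * f y) : As X →* G :=
  PresentedGroup.toGroup (f := f) (by
    rintro r ⟨x, y, rfl⟩
    simp [hf, mul_assoc])

@[simp]
theorem As.lift_e {X : Type u} [Quandle X] {G : Type v} [Group G] (f : X → G)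
    (hf : ∀ x y, f (x ⊲ y) = (f y)⁻¹ * f x * f y) (x : X) : As.lift f hf (e x) = f x :=
  PresentedGroup.toGroup.of _

/-- The homomorphism `f_* : As(X) → As(Y)`, `e_x ↦ e_{f x}`, induced by a quandle homomorphism. -/
def As.map {X : Type u} {Y : Type v} [Quandle X] [Quandle Y] (f : ShelfHom X Y) : As X →* As Y :=
  As.lift (fun x => e (f x)) (fun x y => by
    have h : f (x ⊲ y) = f x ⊲ f y := f.map_act'
    rw [h, e_rop])

/-- The homomorphism `ε : As(X) → ℤ` sending every generator `e_x` to `1`. -/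
def eps (X : Type u) [Quandle X] : As X →* Multiplicative ℤ :=
  As.lift (fun _ => Multiplicative.ofAdd 1) (fun _ _ => by simp)

/-- The right action of `As(X)` on `X`, as a homomorphism to the opposite of the group of
permutations: `e_y` acts by `x ↦ x ⊲ y`. -/
def actHom (X : Type u) [Quandle X] : As X →* (Equiv.Perm X)ᵐᵒᵖ :=
  As.lift (fun y => MulOpposite.op (Rack.act' y)) (fun x y => by
    change MulOpposite.op (Rack.act' (Shelf.act y x)) = _
    rw [Rack.ad_conj]
    simp [mul_assoc])

/-- `x · g` for `x ∈ X` and `g ∈ As(X)`. -/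
def ract {X : Type u} [Quandle X] (x : X) (g : As X) : X := (actHom X g).unop x

theorem ract_e {X : Type u} [Quandle X] (x y : X) : ract x (e y) = x ⊲ y := by
  simp [ract, actHom, rop]

theorem ract_one {X : Type u} [Quandle X] (x : X) : ract x 1 = x := by
  simp [ract]

theorem ract_mul {X : Type u} [Quandle X] (x : X) (g h : As X) :
    ract x (g * h) = ract (ract x g) h := by
  simp [ract]

/-- `e_{x · g} = g⁻¹ e_x g`. -/
theorem e_ract {X : Type u} [Quandle X] (g : As X) (x : X) : e (ract x g) = g⁻¹ * e x * g := by
  have hg : g ∈ Subgroup.closure (Set.range (PresentedGroup.of (rels := asRels X))) := by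
    rw [PresentedGroup.closure_range_of]; trivial
  induction hg using Subgroup.closure_induction generalizing x with
  | mem g hg =>
    obtain ⟨y, rfl⟩ := hg
    exact (congrArg e (ract_e x y)).trans (e_rop x y)
  | one => simp [ract_one]
  | mul g h _ _ ihg ihh => rw [ract_mul, ihh, ihg]; group
  | inv g _ ih =>
    have h := ih (ract x g⁻¹)
    rw [← ract_mul, inv_mul_cancel, ract_one] at h
    rw [h]; group

/-- A quandle is connected if the action of `As(X)` has exactly one orbit. -/
def IsConnected (X : Type u) [Quandle X] : Prop :=
  Nonempty X ∧ ∀ x y : X, ∃ g : As X, ract x g = y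

/-- `X` is of (finite) type `t`: `t` is the minimal `N > 0` such that `x ⊲^N y = x` for all
`x, y ∈ X`, where `• ⊲^N y` is the `N`-fold application of `• ⊲ y`. -/
def IsType (X : Type u) [Quandle X] (t : ℕ) : Prop :=
  IsLeast {N : ℕ | 0 < N ∧ ∀ x y : X, (fun z => z ⊲ y)^[N] x = x} t

/-! ### The universal covering -/

/-- The underlying set `Ker ε` of the universal covering of `X` based at `a`. -/
def Cover (X : Type u) [Quandle X] (_a : X) : Type u := (eps X).ker

namespace Cover

variable {X : Type u} [Quandle X] {a : X}

theorem eps_e (x : X) : eps X (e x) = Multiplicative.ofAdd 1 := As.lift_e _ _ _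

theorem eps_coe (g : Cover X a) : eps X g.1 = 1 := g.2

@[ext]
theorem ext {g h : Cover X a} (H : g.1 = h.1) : g = h := Subtype.ext H

/-- The quandle structure `g ⊲ h = e_a⁻¹ g h⁻¹ e_a h` on `Ker ε`. -/
instance : Quandle (Cover X a) where
  act h g := ⟨(e a)⁻¹ * g.1 * h.1⁻¹ * e a * h.1, by
    simp [MonoidHom.mem_ker, eps_coe]⟩
  invAct h g := ⟨e a * g.1 * h.1⁻¹ * (e a)⁻¹ * h.1, by
    simp [MonoidHom.mem_ker, eps_coe]⟩
  self_distrib {x y z} := by ext; simp only; group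
  left_inv x y := by ext; simp only; group
  right_inv x y := by ext; simp only; group
  fix {x} := by ext; simp only; group

theorem coe_rop (g h : Cover X a) : (g ⊲ h).1 = (e a)⁻¹ * g.1 * h.1⁻¹ * e a * h.1 := rfl

/-- The universal covering `p : X̃ → X`, `g ↦ a · g`. -/
def proj (a : X) : ShelfHom (Cover X a) X where
  toFun g := ract a g.1
  map_act' {h g} := by
    change ract a ((e a)⁻¹ * g.1 * h.1⁻¹ * e a * h.1) = ract a g.1 ⊲ ract a h.1
    have h1 : ract a (e a)⁻¹ = a := by
      have := ract_mul a (e a) (e a)⁻¹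
      rw [mul_inv_cancel, ract_one, ract_e, rop_self] at this
      exact this.symm
    rw [← ract_e (ract a g.1), e_ract, ← ract_mul, mul_assoc, mul_assoc, mul_assoc, ract_mul, h1]
    simp only [mul_assoc]

end Cover

/-! ### Quandle homology -/

/-- `C_n^R(X)`, the free `ℤ`-module on `X^n`. -/
abbrev RackChain (X : Type u) (n : ℕ) : Type u := (Fin n → X) →₀ ℤ

/-- The tuple `(x_1, …, x_{i-1}, x_{i+1}, …, x_{n+1})`. -/
def face0 {X : Type u} {n : ℕ} (i : Fin (n + 1)) (x : Fin (n + 1) → X) : Fin n → X :=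
  fun j => x (i.succAbove j)

/-- The tuple `(x_1 ⊲ x_i, …, x_{i-1} ⊲ x_i, x_{i+1}, …, x_{n+1})`. -/
def face1 {X : Type u} [Quandle X] {n : ℕ} (i : Fin (n + 1)) (x : Fin (n + 1) → X) : Fin n → X :=
  fun j => if (j : ℕ) < (i : ℕ) then x (i.succAbove j) ⊲ x i else x (i.succAbove j)

/-- The boundary `∂ : C_{n+1}^R(X) → C_n^R(X)`. The sign of the `i`-th term, counted from `0`,
is `(-1)^(i+1)`. -/
noncomputable def rackBoundary (X : Type u) [Quandle X] (n : ℕ) :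
    RackChain X (n + 1) →ₗ[ℤ] RackChain X n :=
  Finsupp.linearCombination ℤ fun x : Fin (n + 1) → X =>
    ∑ i : Fin (n + 1), (-1 : ℤ) ^ ((i : ℕ) + 1) •
      (Finsupp.single (face1 i x) (1 : ℤ) - Finsupp.single (face0 i x) (1 : ℤ))

/-- The tuple `x` has two equal consecutive entries. -/
def IsDegenerate {X : Type u} {n : ℕ} (x : Fin n → X) : Prop :=
  ∃ i j : Fin n, (i : ℕ) + 1 = (j : ℕ) ∧ x i = x j

/-- `C_n^D(X)`, the submodule of `C_n^R(X)` generated by the degenerate tuples. -/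
noncomputable def degenerateChain (X : Type u) (n : ℕ) : Submodule ℤ (RackChain X n) :=
  Submodule.span ℤ {c | ∃ x : Fin n → X, IsDegenerate x ∧ c = Finsupp.single x 1}

theorem single_mem_degenerateChain {X : Type u} {n : ℕ} {x : Fin n → X} (hx : IsDegenerate x) :
    Finsupp.single x (1 : ℤ) ∈ degenerateChain X n :=
  Submodule.subset_span ⟨x, hx, rfl⟩

theorem rackBoundary_single {X : Type u} [Quandle X] {n : ℕ} (x : Fin (n + 1) → X) :
    rackBoundary X n (Finsupp.single x 1) =
      ∑ i : Fin (n + 1), (-1 : ℤ) ^ ((i : ℕ) + 1) •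
        (Finsupp.single (face1 i x) (1 : ℤ) - Finsupp.single (face0 i x) (1 : ℤ)) := by
  simp [rackBoundary]

theorem succAbove_of_lt {n : ℕ} {i : Fin (n + 1)} {j : Fin n} (h : (j : ℕ) < (i : ℕ)) :
    i.succAbove j = j.castSucc := Fin.succAbove_of_castSucc_lt _ _ h

theorem succAbove_of_not_lt {n : ℕ} {i : Fin (n + 1)} {j : Fin n} (h : ¬ (j : ℕ) < (i : ℕ)) :
    i.succAbove j = j.succ := Fin.succAbove_of_le_castSucc _ _ (not_lt.mp h)

/-- The degenerate chains form a subcomplex. -/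
theorem degenerateChain_le_comap (X : Type u) [Quandle X] (n : ℕ) :
    degenerateChain X (n + 1) ≤ (degenerateChain X n).comap (rackBoundary X n) := by
  rw [degenerateChain, Submodule.span_le]
  rintro _ ⟨x, ⟨k, l, hkl, hx⟩, rfl⟩
  change rackBoundary X n (Finsupp.single x 1) ∈ degenerateChain X n
  rw [rackBoundary_single, ← Submodule.Quotient.mk_eq_zero, ← Submodule.mkQ_apply, map_sum]
  have hne : k ≠ l := fun h => by subst h; omega
  rw [Finset.sum_eq_add k l hne ?_ (by simp) (by simp)]
  · have h0 : face0 k x = face0 l x := by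
      funext j
      by_cases h1 : (j : ℕ) < k
      · have h2 : (j : ℕ) < l := by omega
        simp [face0, succAbove_of_lt h1, succAbove_of_lt h2]
      · by_cases h2 : (j : ℕ) < l
        · have h3 : j.succ = l := Fin.ext (by simp; omega)
          have h4 : j.castSucc = k := Fin.ext (by simp; omega)
          simp [face0, succAbove_of_not_lt h1, succAbove_of_lt h2, h3, h4, hx]
        · simp [face0, succAbove_of_not_lt h1, succAbove_of_not_lt h2]
    have h1 : face1 k x = face1 l x := by
      funext j
      by_cases h1 : (j : ℕ) < k
      · have h2 : (j : ℕ) < l := by omega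
        simp [face1, h1, h2, succAbove_of_lt h1, succAbove_of_lt h2, hx]
      · by_cases h2 : (j : ℕ) < l
        · have h3 : j.succ = l := Fin.ext (by simp; omega)
          have h4 : j.castSucc = k := Fin.ext (by simp; omega)
          simp [face1, h1, h2, succAbove_of_not_lt h1, succAbove_of_lt h2, h3, h4, hx, rop_self]
        · simp [face1, h1, h2, succAbove_of_not_lt h1, succAbove_of_not_lt h2]
    rw [h0, h1, ← hkl, pow_succ _ ((k : ℕ) + 1), ← map_add]
    simp
  · rintro i - ⟨hik, hil⟩
    have hik' : (i : ℕ) ≠ k := fun h => hik (Fin.ext h)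
    have hil' : (i : ℕ) ≠ l := fun h => hil (Fin.ext h)
    rw [Submodule.mkQ_apply, Submodule.Quotient.mk_eq_zero]
    refine Submodule.smul_mem _ _ (Submodule.sub_mem _ ?_ ?_) <;>
      refine single_mem_degenerateChain ?_
    all_goals
      by_cases h : (k : ℕ) < i
      · have hl : (l : ℕ) < i := by omega
        refine ⟨⟨k, by omega⟩, ⟨l, by omega⟩, hkl, ?_⟩
        have e1 : i.succAbove ⟨k, by omega⟩ = k := succAbove_of_lt (i := i) (j := ⟨k, by omega⟩) h
        have e2 : i.succAbove ⟨l, by omega⟩ = l := succAbove_of_lt (i := i) (j := ⟨l, by omega⟩) hl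
        simp [face0, face1, e1, e2, h, hl, hx]
      · have hl : (i : ℕ) < l := by omega
        refine ⟨⟨k - 1, by omega⟩, ⟨l - 1, by omega⟩, by simp; omega, ?_⟩
        have n1 : ¬ (k : ℕ) - 1 < i := by omega
        have n2 : ¬ (l : ℕ) - 1 < i := by omega
        have e1 : i.succAbove ⟨k - 1, by omega⟩ = k :=
          (succAbove_of_not_lt (i := i) (j := ⟨k - 1, by omega⟩) n1).trans
            (Fin.ext (by simp; omega))
        have e2 : i.succAbove ⟨l - 1, by omega⟩ = l :=
          (succAbove_of_not_lt (i := i) (j := ⟨l - 1, by omega⟩) n2).trans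
            (Fin.ext (by simp; omega))
        simp [face0, face1, e1, e2, n1, n2, hx]

/-- The chain group `C_n^R(X) / C_n^D(X)` of the quandle complex. -/
abbrev QuandleChain (X : Type u) (n : ℕ) : Type u := RackChain X n ⧸ degenerateChain X n

/-- The boundary of the quandle complex. -/
noncomputable def quandleBoundary (X : Type u) [Quandle X] (n : ℕ) :
    QuandleChain X (n + 1) →ₗ[ℤ] QuandleChain X n :=
  (degenerateChain X (n + 1)).mapQ (degenerateChain X n) (rackBoundary X n)
    (degenerateChain_le_comap X n)

/-- The cycles in degree `n`; every chain of degree `0` is a cycle. -/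
noncomputable def quandleCycles (X : Type u) [Quandle X] : (n : ℕ) → Submodule ℤ (QuandleChain X n)
  | 0 => ⊤
  | n + 1 => LinearMap.ker (quandleBoundary X n)

/-- The boundaries in degree `n`. -/
noncomputable def quandleBoundaries (X : Type u) [Quandle X] (n : ℕ) :
    Submodule ℤ (QuandleChain X n) :=
  LinearMap.range (quandleBoundary X n)

/-- The quandle homology `H_n^Q(X)`: cycles modulo boundaries. -/
abbrev QuandleHomology (X : Type u) [Quandle X] (n : ℕ) : Type u :=
  quandleCycles X n ⧸ (quandleBoundaries X n).submoduleOf (quandleCycles X n)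

end NosakaQuandle

namespace NosakaQuandle

universe u v

/-! ### The adjoint group and connectedness -/

section Adjoint

variable {Y : Type u} [Quandle Y]

/-! The second homology behaves like a fundamental group. For a quandle `Y` with base point `y₀`,
`As(Y)` acts on `Y × C₂/B₂` by `(x, q) · e_y = (x ⊲ y, q + [(x, y)])`. The cocycle relation makes
this an action, so each `g` has a sum of pairs `pathSum g y` along its path from `y`. Its boundary
is `y · g - y`, so elements fixing `y₀` give cycles.

For the way back, choose `s(y)` in `Ker ε` carrying `y₀` to `y` and send `(x, y)` to `e_{y₀}⁻¹ s(x)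
e_y s(x ⊲ y)⁻¹`. This lies in the reduced stabilizer of `y₀`. When that stabilizer is central, the
assignment is a cocycle, called `holonomy`. It inverts `pathSum` on loops (`holonomy_pathSum_base`)
and on cycles (`exists_pathSum_holonomy`), so `H₂(Y)` is the reduced stabilizer.

For the covering, `G` acts by `g ↦ e_a ^ (-ε(G)) g p_*(G)` (`ract_coe`). So every reduced stabilizer
equals `Ker p_*`, which then acts trivially and is central.

If `x ⊲^t y = x` holds in `X`, it holds in the covering, where all `e_g ^ t` then agree. Modulo
central `t`-torsion `e_g` depends only on `p(g)`, so the quotient map factors through `p_*`, and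
`Ker p_*` is `t`-torsion. -/

theorem As.induction {p : As Y → Prop} (gen : ∀ y, p (e y)) (one : p 1)
    (mul : ∀ g h, p g → p h → p (g * h)) (inv : ∀ g, p g → p g⁻¹) (g : As Y) : p g := by
  have hg : g ∈ Subgroup.closure (Set.range (PresentedGroup.of (rels := asRels Y))) := by
    rw [PresentedGroup.closure_range_of]; trivial
  induction hg using Subgroup.closure_induction with
  | mem g hg => obtain ⟨y, rfl⟩ := hg; exact gen y
  | one => exact one
  | mul g h _ _ hg hh => exact mul g h hg hh
  | inv g _ hg => exact inv g hg

theorem As.hom_ext {G : Type v} [Group G] {φ ψ : As Y →* G} (h : ∀ y, φ (e y) = ψ (e y)) :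
    φ = ψ :=
  PresentedGroup.ext h

theorem As.map_e {Z : Type v} [Quandle Z] (f : ShelfHom Y Z) (y : Y) :
    As.map f (e y) = e (f y) :=
  As.lift_e _ _ _

/-- Conjugating by `g` sends `e_y` to `e_{y · g}`, so a trivial action fixes all generators. -/
theorem As.mem_center {g : As Y} (h : ∀ y, ract y g = y) : g ∈ Subgroup.center (As Y) := by
  rw [Subgroup.mem_center_iff]
  intro k
  induction k using As.induction with
  | gen y =>
    have h1 := e_ract g y
    rw [h y] at h1
    calc e y * g = g * (g⁻¹ * e y * g) := by group
      _ = g * e y := by rw [← h1]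
  | one => simp
  | mul k l hk hl => rw [mul_assoc, hl, ← mul_assoc, hk, mul_assoc]
  | inv k hk => rw [inv_mul_eq_iff_eq_mul, ← mul_assoc, hk, mul_assoc, mul_inv_cancel, mul_one]

@[simp]
theorem eps_e (y : Y) : eps Y (e y) = Multiplicative.ofAdd 1 := As.lift_e _ _ _

theorem ract_self_e (y : Y) : ract y (e y) = y := by rw [ract_e, rop_self]

theorem ract_inv {x y : Y} {g : As Y} (h : ract x g = y) : ract y g⁻¹ = x := by
  rw [← h, ← ract_mul, mul_inv_cancel, ract_one]

theorem ract_self_zpow (y : Y) (n : ℤ) : ract y (e y ^ n) = y := by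
  induction n using Int.induction_on with
  | zero => simp [ract_one]
  | succ n ih => rw [zpow_add_one, ract_mul, ih, ract_self_e]
  | pred n ih => rw [zpow_sub_one, ract_mul, ih, ract_inv (ract_self_e y)]

theorem ract_pow (x y : Y) (n : ℕ) : ract x (e y ^ n) = (fun z => z ⊲ y)^[n] x := by
  induction n with
  | zero => simp [ract_one]
  | succ n ih => rw [pow_succ, ract_mul, ih, ract_e, Function.iterate_succ_apply']

/-- In a connected quandle, any two elements are related by an element of `Ker ε`. -/
theorem IsConnected.exists_ract_eq (hY : IsConnected Y) (x y : Y) :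
    ∃ g : As Y, ract x g = y ∧ eps Y g = 1 := by
  obtain ⟨g, hg⟩ := hY.2 x y
  -- Since `e_x` fixes `x`, a power of it in front corrects the degree without moving the endpoint.
  refine ⟨e x ^ (-(eps Y g).toAdd) * g, by rw [ract_mul, ract_self_zpow, hg], ?_⟩
  rw [map_mul, map_zpow, eps_e, ← ofAdd_zsmul]
  simp

/-- The elements of `Ker ε` that fix `y`. -/
def reducedStabilizer (y : Y) : Subgroup (As Y) where
  carrier := {g | ract y g = y ∧ eps Y g = 1}
  one_mem' := ⟨ract_one y, map_one _⟩
  mul_mem' := fun {g h} hg hh => ⟨by rw [ract_mul, hg.1, hh.1], by rw [map_mul, hg.2, hh.2, mul_one]⟩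
  inv_mem' := fun {g} hg => ⟨ract_inv hg.1, by rw [map_inv, hg.2, inv_one]⟩

theorem mem_reducedStabilizer {y : Y} {g : As Y} :
    g ∈ reducedStabilizer y ↔ ract y g = y ∧ eps Y g = 1 := Iff.rfl

end Adjoint

/-! ### Low-dimensional quandle chains -/

section Chains

variable {Y : Type u}

/-- The class of a tuple in the quandle complex. -/
noncomputable def chain {n : ℕ} (v : Fin n → Y) : QuandleChain Y n :=
  (degenerateChain Y n).mkQ (Finsupp.single v 1)

theorem chain_eq_zero {n : ℕ} {v : Fin n → Y} (hv : IsDegenerate v) : chain v = 0 := by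
  rw [chain, Submodule.mkQ_apply, Submodule.Quotient.mk_eq_zero]
  exact single_mem_degenerateChain hv

theorem QuandleChain.hom_ext {n : ℕ} {M : Type v} [AddCommGroup M]
    {f g : QuandleChain Y n →ₗ[ℤ] M} (h : ∀ v, f (chain v) = g (chain v)) : f = g := by
  apply Submodule.linearMap_qext
  apply Finsupp.lhom_ext'
  intro v
  ext
  exact h v

/-- The linear map on quandle chains given by its values on tuples. -/
noncomputable def QuandleChain.lift {n : ℕ} {M : Type v} [AddCommGroup M] (f : (Fin n → Y) → M)
    (hf : ∀ v, IsDegenerate v → f v = 0) : QuandleChain Y n →ₗ[ℤ] M :=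
  (degenerateChain Y n).liftQ (Finsupp.linearCombination ℤ f) (by
    rw [degenerateChain, Submodule.span_le]
    rintro _ ⟨v, hv, rfl⟩
    simp [hf v hv])

@[simp]
theorem QuandleChain.lift_chain {n : ℕ} {M : Type v} [AddCommGroup M] (f : (Fin n → Y) → M)
    (hf : ∀ v, IsDegenerate v → f v = 0) (v : Fin n → Y) :
    QuandleChain.lift f hf (chain v) = f v := by
  simp [QuandleChain.lift, chain]

theorem forall_fin_three {p : (Fin 3 → Y) → Prop} (h : ∀ x y z, p ![x, y, z]) (v : Fin 3 → Y) :
    p v := by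
  have hv : v = ![v 0, v 1, v 2] := by ext j; fin_cases j <;> rfl
  rw [hv]; exact h _ _ _

theorem forall_fin_two {p : (Fin 2 → Y) → Prop} (h : ∀ x y, p ![x, y]) (v : Fin 2 → Y) :
    p v := by
  have hv : v = ![v 0, v 1] := by ext j; fin_cases j <;> rfl
  rw [hv]; exact h _ _

theorem isDegenerate_two {v : Fin 2 → Y} (h : IsDegenerate v) : v 0 = v 1 := by
  obtain ⟨i, j, hij, h⟩ := h
  have hi : i = 0 := by ext; simp; omega
  have hj : j = 1 := by ext; simp; omega
  rwa [hi, hj] at h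

theorem not_isDegenerate_one (v : Fin 1 → Y) : ¬ IsDegenerate v := by
  rintro ⟨i, j, hij, -⟩
  omega

variable [Quandle Y]

theorem quandleBoundary_chain {n : ℕ} (v : Fin (n + 1) → Y) :
    quandleBoundary Y n (chain v) =
      ∑ i : Fin (n + 1), (-1 : ℤ) ^ ((i : ℕ) + 1) • (chain (face1 i v) - chain (face0 i v)) := by
  rw [chain, quandleBoundary, Submodule.mkQ_apply, Submodule.mapQ_apply, rackBoundary_single,
    ← Submodule.mkQ_apply, map_sum]
  simp only [map_smul, map_sub, chain]

theorem quandleBoundary_one (x y : Y) :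
    quandleBoundary Y 1 (chain ![x, y]) = chain ![x ⊲ y] - chain ![x] := by
  have h00 : face0 0 ![x, y] = ![y] := by ext j; fin_cases j; rfl
  have h10 : face1 0 ![x, y] = ![y] := by ext j; fin_cases j; rfl
  have h01 : face0 1 ![x, y] = ![x] := by ext j; fin_cases j; rfl
  have h11 : face1 1 ![x, y] = ![x ⊲ y] := by ext j; fin_cases j; rfl
  rw [quandleBoundary_chain, Fin.sum_univ_two, h00, h10, h01, h11]
  simp

theorem quandleBoundary_two (x y z : Y) :
    quandleBoundary Y 2 (chain ![x, y, z]) =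
      (chain ![x, y] + chain ![x ⊲ y, z]) - (chain ![x, z] + chain ![x ⊲ z, y ⊲ z]) := by
  have h00 : face0 0 ![x, y, z] = ![y, z] := by ext j; fin_cases j <;> rfl
  have h10 : face1 0 ![x, y, z] = ![y, z] := by ext j; fin_cases j <;> rfl
  have h01 : face0 1 ![x, y, z] = ![x, z] := by ext j; fin_cases j <;> rfl
  have h11 : face1 1 ![x, y, z] = ![x ⊲ y, z] := by ext j; fin_cases j <;> rfl
  have h02 : face0 2 ![x, y, z] = ![x, y] := by ext j; fin_cases j <;> rfl
  have h12 : face1 2 ![x, y, z] = ![x ⊲ z, y ⊲ z] := by ext j; fin_cases j <;> rfl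
  rw [quandleBoundary_chain, Fin.sum_univ_three, h00, h10, h01, h11, h02, h12]
  simp
  abel

theorem quandleBoundaries_two_le_ker {M : Type v} [AddCommGroup M] (f : QuandleChain Y 2 →ₗ[ℤ] M)
    (hf : ∀ x y z, f (chain ![x, y]) + f (chain ![x ⊲ y, z]) =
      f (chain ![x, z]) + f (chain ![x ⊲ z, y ⊲ z])) :
    quandleBoundaries Y 2 ≤ LinearMap.ker f := by
  rw [quandleBoundaries, LinearMap.range_le_ker_iff]
  apply QuandleChain.hom_ext
  apply forall_fin_three
  intro x y z
  rw [LinearMap.comp_apply, quandleBoundary_two, map_sub, map_add, map_add, hf, sub_self,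
    LinearMap.zero_apply]

variable (Y) in
/-- The `2`-chains of the quandle complex modulo boundaries. -/
abbrev ChainsModBoundaries : Type u := QuandleChain Y 2 ⧸ quandleBoundaries Y 2

/-- The class of the pair `(x, y)` modulo boundaries. -/
noncomputable def pair (x y : Y) : ChainsModBoundaries Y :=
  (quandleBoundaries Y 2).mkQ (chain ![x, y])

theorem pair_self (x : Y) : pair x x = 0 := by
  rw [pair, chain_eq_zero ⟨0, 1, rfl, rfl⟩, map_zero]

theorem pair_cocycle (x y z : Y) :
    pair x y + pair (x ⊲ y) z = pair x z + pair (x ⊲ z) (y ⊲ z) := by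
  rw [← sub_eq_zero]
  simp only [pair, ← map_add, ← map_sub]
  rw [← quandleBoundary_two, Submodule.mkQ_apply, Submodule.Quotient.mk_eq_zero]
  exact ⟨_, rfl⟩

/-- The boundary, as a map on `2`-chains modulo boundaries. -/
noncomputable def boundaryMod : ChainsModBoundaries Y →ₗ[ℤ] QuandleChain Y 1 :=
  (quandleBoundaries Y 2).liftQ (quandleBoundary Y 1) (quandleBoundaries_two_le_ker _ (by
    intro x y z
    simp only [quandleBoundary_one]
    rw [rop_distrib]
    abel))

theorem boundaryMod_mkQ (c : QuandleChain Y 2) :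
    boundaryMod ((quandleBoundaries Y 2).mkQ c) = quandleBoundary Y 1 c := rfl

theorem boundaryMod_pair (x y : Y) : boundaryMod (pair x y) = chain ![x ⊲ y] - chain ![x] := by
  rw [pair, boundaryMod_mkQ, quandleBoundary_one]

end Chains

/-! ### Sums along paths -/

section Paths

open scoped IsMulCommutative

variable {Y : Type u} [Quandle Y]

/-- The permutation `(x, q) ↦ (x ⊲ y, q + [(x, y)])`. -/
noncomputable def stepPerm (y : Y) : Equiv.Perm (Y × ChainsModBoundaries Y) where
  toFun w := (w.1 ⊲ y, w.2 + pair w.1 y)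
  invFun w := (Rack.invAct y w.1, w.2 - pair (Rack.invAct y w.1) y)
  left_inv w := by simp [rop]
  right_inv w := by simp [rop]

theorem stepPerm_apply (y x : Y) (q : ChainsModBoundaries Y) :
    stepPerm y (x, q) = (x ⊲ y, q + pair x y) := rfl

variable (Y) in
/-- The right action of `As(Y)` on `Y × C₂ / B₂` for which `e_y` acts by `stepPerm y`. -/
noncomputable def pathHom : As Y →* (Equiv.Perm (Y × ChainsModBoundaries Y))ᵐᵒᵖ :=
  As.lift (fun y => MulOpposite.op (stepPerm y)) (fun x y => by
    rw [mul_assoc, eq_inv_mul_iff_mul_eq, ← MulOpposite.op_mul, ← MulOpposite.op_mul]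
    congr 1
    ext1 ⟨w, q⟩
    simp only [Equiv.Perm.mul_apply, stepPerm_apply, add_assoc]
    rw [rop_distrib w x y, pair_cocycle w x y])

/-- The sum of the pairs along the path that starts at `y` and is given by a word for `g`. -/
noncomputable def pathSum (g : As Y) (y : Y) : ChainsModBoundaries Y :=
  ((pathHom Y g).unop (y, 0)).2

theorem pathHom_e (x y : Y) (q : ChainsModBoundaries Y) :
    (pathHom Y (e x)).unop (y, q) = (y ⊲ x, q + pair y x) := by
  simp [pathHom, stepPerm_apply]

/-- Each generator shifts the second coordinate by an amount depending only on the first, so the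
action commutes with translations of `C₂/B₂`. -/
theorem pathHom_apply (g : As Y) (y : Y) (q : ChainsModBoundaries Y) :
    (pathHom Y g).unop (y, q) = (ract y g, q + pathSum g y) := by
  induction g using As.induction generalizing y q with
  | gen x => simp only [pathSum, pathHom_e, ract_e, zero_add]
  | one => simp [pathSum, ract_one]
  | mul g h hg hh =>
    simp only [pathSum, map_mul, MulOpposite.unop_mul, Equiv.Perm.mul_apply, ract_mul]
    rw [hg, hg, hh, hh]
    simp [add_assoc]
  | inv g hg =>
    have key : ∀ q, (pathHom Y g⁻¹).unop (y, q) =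
        (ract y g⁻¹, q - pathSum g (ract y g⁻¹)) := by
      intro q
      rw [map_inv, MulOpposite.unop_inv, Equiv.Perm.inv_eq_iff_eq, hg, ← ract_mul]
      simp [ract_one]
    rw [pathSum, key, key]
    simp [sub_eq_add_neg]

theorem pathSum_e (x y : Y) : pathSum (e x) y = pair y x := by
  rw [pathSum, pathHom_e, zero_add]

theorem pathSum_one (y : Y) : pathSum 1 y = 0 := by simp [pathSum]

theorem pathSum_mul (g h : As Y) (y : Y) :
    pathSum (g * h) y = pathSum g y + pathSum h (ract y g) := by
  rw [pathSum, map_mul, MulOpposite.unop_mul, Equiv.Perm.mul_apply, pathHom_apply, pathHom_apply,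
    zero_add]

theorem pathSum_inv (g : As Y) (y : Y) : pathSum g⁻¹ y = -pathSum g (ract y g⁻¹) := by
  rw [eq_neg_iff_add_eq_zero, ← pathSum_mul, inv_mul_cancel, pathSum_one]

/-- The boundaries of successive edges telescope. -/
theorem boundaryMod_pathSum (g : As Y) (y : Y) :
    boundaryMod (pathSum g y) = chain ![ract y g] - chain ![y] := by
  induction g using As.induction generalizing y with
  | gen x => rw [pathSum_e, boundaryMod_pair, ract_e]
  | one => simp [pathSum_one, ract_one]
  | mul g h hg hh => rw [pathSum_mul, map_add, hg, hh, ract_mul]; abel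
  | inv g hg =>
    rw [pathSum_inv, map_neg, hg, ← ract_mul, inv_mul_cancel, ract_one]; abel

variable (Y) in
/-- The pairs `(y₀, s)` where `s` assigns to `y ∈ Y` an element of `Ker ε` carrying `y₀` to `y`,
in the case where the elements of `Ker ε` fixing `y₀` are central. -/
structure Spanning where
  /-- the base point -/
  base : Y
  /-- the chosen element of `Ker ε` -/
  path : Y → As Y
  ract_path : ∀ y, ract base (path y) = y
  eps_path : ∀ y, eps Y (path y) = 1
  le_center : reducedStabilizer base ≤ Subgroup.center (As Y)

/-! ### Holonomy and its inverse on second homology. -/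

namespace Spanning

variable (S : Spanning Y)

theorem loop_mem (x y : Y) : (e S.base)⁻¹ * S.path x * e y * (S.path (x ⊲ y))⁻¹ ∈
    reducedStabilizer S.base := by
  refine ⟨?_, ?_⟩
  · rw [ract_mul, ract_mul, ract_mul, ract_inv (ract_self_e S.base), S.ract_path, ract_e,
      ract_inv (S.ract_path _)]
  · simp [S.eps_path]

/-- The loop at the base point through the edge `(x, y)`, normalized to lie in `Ker ε`. -/
def loop (x y : Y) : Subgroup.center (As Y) :=
  ⟨(e S.base)⁻¹ * S.path x * e y * (S.path (x ⊲ y))⁻¹, S.le_center (S.loop_mem x y)⟩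

theorem loop_spec (x y : Y) :
    e S.base * (S.loop x y : As Y) * S.path (x ⊲ y) = S.path x * e y := by
  simp only [loop]; group

theorem central (k : Subgroup.center (As Y)) (g : As Y) : g * (k : As Y) = k * g :=
  Subgroup.mem_center_iff.mp k.2 g

/-- Since `x` is the base point moved by `s(x)`, `e_x` is the conjugate of `e_{y₀}` by `s(x)`; hence
degenerate pairs have trivial holonomy. -/
theorem loop_self (x : Y) : S.loop x x = 1 := by
  ext
  have h := e_ract (S.path x)⁻¹ x
  rw [ract_inv (S.ract_path x), inv_inv] at h
  simp only [loop, rop_self, OneMemClass.coe_one]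
  rw [mul_assoc, mul_assoc, ← mul_assoc (S.path x), ← h, inv_mul_cancel]

theorem loop_mul_loop (x y z : Y) :
    e S.base * e S.base * ((S.loop x y * S.loop (x ⊲ y) z : Subgroup.center (As Y)) : As Y) *
      S.path (x ⊲ y ⊲ z) = S.path x * e y * e z := by
  rw [← S.loop_spec x y, mul_assoc _ (S.path (x ⊲ y)), ← S.loop_spec (x ⊲ y) z, Subgroup.coe_mul]
  simp only [mul_assoc]
  congr 1
  simp only [← mul_assoc]
  rw [central (S.loop x y) (e S.base)]

/-- Both sides are determined by the same endpoint and the same product, because `e_z e_{y ⊲ z} =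
e_y e_z`. -/
theorem loop_cocycle (x y z : Y) :
    S.loop x y * S.loop (x ⊲ y) z = S.loop x z * S.loop (x ⊲ z) (y ⊲ z) := by
  have h1 := S.loop_mul_loop x y z
  have h2 := S.loop_mul_loop x z (y ⊲ z)
  rw [← rop_distrib] at h2
  have h3 : S.path x * e z * e (y ⊲ z) = S.path x * e y * e z := by rw [e_rop]; group
  rw [h3, ← h1] at h2
  exact (Subtype.ext (mul_left_cancel (mul_right_cancel h2))).symm

/-- The linear map `C₂ → Z(As(Y))` sending a pair to its loop. -/
noncomputable def holonomyChain : QuandleChain Y 2 →ₗ[ℤ] Additive (Subgroup.center (As Y)) :=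
  QuandleChain.lift (fun v => Additive.ofMul (S.loop (v 0) (v 1))) (fun v hv => by
    rw [isDegenerate_two hv, loop_self, ofMul_one])

/-- The linear map `C₂ / B₂ → Z(As(Y))` sending a pair to its loop. -/
noncomputable def holonomy : ChainsModBoundaries Y →ₗ[ℤ] Additive (Subgroup.center (As Y)) :=
  (quandleBoundaries Y 2).liftQ S.holonomyChain (quandleBoundaries_two_le_ker _ (by
    intro x y z
    simp only [holonomyChain, QuandleChain.lift_chain]
    exact congrArg Additive.ofMul (S.loop_cocycle x y z)))

theorem holonomy_pair (x y : Y) : S.holonomy (pair x y) = Additive.ofMul (S.loop x y) := by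
  simp [holonomy, pair, holonomyChain]

/-- The homomorphism `g ↦ e_{y₀} ^ ε(g)`. -/
def degreeHom : As Y →* As Y := (zpowersHom (As Y) (e S.base)).comp (eps Y)

theorem degreeHom_e (y : Y) : S.degreeHom (e y) = e S.base := by simp [degreeHom]

/-- Multiply `loop_spec` along a word for `g`: the intermediate `s` cancel, the central loops
collect into the holonomy, and the factors `e_{y₀}` into `degreeHom g`. -/
theorem holonomy_pathSum (g : As Y) (y : Y) :
    S.degreeHom g * ((S.holonomy (pathSum g y)).toMul : As Y) * S.path (ract y g) =
      S.path y * g := by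
  induction g using As.induction generalizing y with
  | gen x => rw [pathSum_e, holonomy_pair, degreeHom_e, ract_e]; exact S.loop_spec y x
  | one => simp [pathSum_one, ract_one]
  | mul g h hg hh =>
    rw [← mul_assoc, ← hg y, mul_assoc _ (S.path _), ← hh, pathSum_mul, map_add, toMul_add,
      map_mul, ract_mul, Subgroup.coe_mul]
    simp only [mul_assoc]
    congr 1
    simp only [← mul_assoc]
    rw [central _ (S.degreeHom h)]
  | inv g hg =>
    have h := hg (ract y g⁻¹)
    rw [← ract_mul, inv_mul_cancel, ract_one] at h
    rw [pathSum_inv, map_neg, toMul_neg, map_inv, Subgroup.coe_inv, eq_mul_inv_iff_mul_eq,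
      mul_assoc, ← h]
    simp only [mul_assoc]
    rw [← mul_assoc (S.degreeHom g), central _ (S.degreeHom g)]
    simp [mul_assoc]

/-- The holonomy of the path sum of a loop is the loop. -/
theorem holonomy_pathSum_base {g : As Y} (hg : g ∈ reducedStabilizer S.base) :
    ((S.holonomy (pathSum g S.base)).toMul : As Y) = g := by
  have h := S.holonomy_pathSum g S.base
  rw [hg.1, degreeHom, MonoidHom.comp_apply, hg.2, map_one, one_mul,
    Subgroup.mem_center_iff.mp (S.le_center hg)] at h
  exact mul_right_cancel h

theorem holonomy_mem (c : ChainsModBoundaries Y) :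
    ((S.holonomy c).toMul : As Y) ∈ reducedStabilizer S.base := by
  obtain ⟨c, rfl⟩ := (quandleBoundaries Y 2).mkQ_surjective c
  obtain ⟨c, rfl⟩ := (degenerateChain Y 2).mkQ_surjective c
  induction c using Finsupp.induction_linear with
  | zero => simp
  | add c d hc hd =>
    rw [map_add, map_add, map_add, toMul_add, Subgroup.coe_mul]
    exact mul_mem hc hd
  | single v n =>
    have h : Finsupp.single v n = n • Finsupp.single v 1 := by simp
    rw [h, map_smul, map_smul, map_smul, toMul_zsmul, Subgroup.coe_zpow]
    refine zpow_mem ?_ n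
    induction v using forall_fin_two with
    | h x y =>
      change ((S.holonomy (pair x y)).toMul : As Y) ∈ _
      rw [holonomy_pair]
      exact S.loop_mem x y

/-- A `2`-chain is the path sum of its holonomy, up to a function of its boundary. -/
theorem exists_pathSum_holonomy : ∃ σ : QuandleChain Y 1 →ₗ[ℤ] ChainsModBoundaries Y,
    ∀ c, pathSum ((S.holonomy c).toMul : As Y) S.base = c - σ (boundaryMod c) := by
  let σ : QuandleChain Y 1 →ₗ[ℤ] ChainsModBoundaries Y :=
    QuandleChain.lift (fun v => pathSum (S.path (v 0)) S.base)
      (fun v hv => (not_isDegenerate_one v hv).elim)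
  have hσ : ∀ y, σ (chain ![y]) = pathSum (S.path y) S.base := fun y =>
    QuandleChain.lift_chain _ _ _
  let τ : ChainsModBoundaries Y →+ ChainsModBoundaries Y :=
    { toFun := fun c => pathSum ((S.holonomy c).toMul : As Y) S.base
      map_zero' := by simp [pathSum_one]
      map_add' := fun c d => by
        -- Holonomies fix the base point, so `pathSum` is additive on them.
        rw [map_add, toMul_add, Subgroup.coe_mul, pathSum_mul, (S.holonomy_mem c).1] }
  refine ⟨σ, fun c => ?_⟩
  have key : τ.toIntLinearMap = LinearMap.id - σ.comp boundaryMod := by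
    apply Submodule.linearMap_qext
    apply QuandleChain.hom_ext
    apply forall_fin_two
    intro x y
    change pathSum ((S.holonomy (pair x y)).toMul : As Y) S.base =
      pair x y - σ (boundaryMod (pair x y))
    rw [boundaryMod_pair, map_sub, hσ, hσ, holonomy_pair, toMul_ofMul]
    simp only [loop]
    -- The factor `e_{y₀}⁻¹` contributes the degenerate pair `(y₀, y₀)`, which is zero; the two `s`
    -- factors give the `σ` terms.
    simp only [pathSum_mul, pathSum_inv, ract_mul, ract_inv (ract_self_e S.base), S.ract_path,
      pathSum_e, pair_self, ract_e, ract_inv (S.ract_path _)]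
    abel
  exact LinearMap.congr_fun key c

/-- The homomorphism `H₂(Y) → As(Y)` sending a cycle to its holonomy. -/
noncomputable def homologyHom : Multiplicative (QuandleHomology Y 2) →* As Y :=
  (Subgroup.center (As Y)).subtype.comp (AddMonoidHom.toMultiplicativeLeft
    (S.holonomy.comp ((Submodule.submoduleOf (quandleBoundaries Y 2) (quandleCycles Y 2)).mapQ
      (quandleBoundaries Y 2) (quandleCycles Y 2).subtype le_rfl)).toAddMonoidHom)

theorem homologyHom_mk (c : quandleCycles Y 2) :
    S.homologyHom (Multiplicative.ofAdd (Submodule.Quotient.mk c)) =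
      ((S.holonomy ((quandleBoundaries Y 2).mkQ c)).toMul : As Y) := rfl

theorem homologyHom_injective : Function.Injective S.homologyHom := by
  rw [injective_iff_map_eq_one]
  intro h hh
  obtain ⟨c, hc⟩ := Submodule.Quotient.mk_surjective _ h.toAdd
  have hc' : h = Multiplicative.ofAdd (Submodule.Quotient.mk c) := by rw [hc, ofAdd_toAdd]
  obtain ⟨σ, hσ⟩ := S.exists_pathSum_holonomy
  have h1 := hσ ((quandleBoundaries Y 2).mkQ c)
  rw [hc', homologyHom_mk] at hh
  have h2 : quandleBoundary Y 1 (c : QuandleChain Y 2) = 0 := c.2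
  rw [hh, pathSum_one, boundaryMod_mkQ, h2, map_zero, sub_zero] at h1
  rw [hc', ← ofAdd_zero]
  congr 1
  rw [Submodule.Quotient.mk_eq_zero]
  exact (Submodule.Quotient.mk_eq_zero (quandleBoundaries Y 2)).mp h1.symm

theorem range_homologyHom : S.homologyHom.range = reducedStabilizer S.base := by
  apply le_antisymm
  · rintro _ ⟨h, rfl⟩
    exact S.holonomy_mem _
  · intro g hg
    obtain ⟨c, hc⟩ := (quandleBoundaries Y 2).mkQ_surjective (pathSum g S.base)
    have hcycle : c ∈ quandleCycles Y 2 := by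
      change quandleBoundary Y 1 c = 0
      rw [← boundaryMod_mkQ, hc, boundaryMod_pathSum, hg.1, sub_self]
    refine ⟨Multiplicative.ofAdd (Submodule.Quotient.mk ⟨c, hcycle⟩), ?_⟩
    rw [homologyHom_mk, hc, S.holonomy_pathSum_base hg]

end Spanning
end Paths

/-! ### The universal covering: action, connectedness and stabilizers. -/

section Cover

variable {X : Type u} [Quandle X] {a : X}

namespace Cover

theorem map_proj_e (g : Cover X a) : As.map (proj a) (e g) = g.1⁻¹ * e a * g.1 := by
  rw [← e_ract]; exact As.map_e _ _

theorem eps_map_proj (G : As (Cover X a)) : eps X (As.map (proj a) G) = eps (Cover X a) G := by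
  have h : (eps X).comp (As.map (proj a)) = eps (Cover X a) := As.hom_ext fun g => by
    simp [map_proj_e, eps_coe, NosakaQuandle.eps_e]
  exact DFunLike.congr_fun h G

/-- An element `G` of `As(X̃)` acts on `X̃` by `g ↦ e_a ^ (-ε(G)) g p_*(G)`. -/
theorem ract_coe (g : Cover X a) (G : As (Cover X a)) :
    e a ^ (eps _ G).toAdd * (ract g G).1 = g.1 * As.map (proj a) G := by
  induction G using As.induction generalizing g with
  | gen h =>
    rw [ract_e, coe_rop, map_proj_e, NosakaQuandle.eps_e]
    simp [mul_assoc]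
  | one => simp [ract_one]
  | mul G H hG hH =>
    rw [ract_mul, map_mul (eps _), map_mul (As.map _), toAdd_mul, zpow_add, mul_assoc, hH,
      ← mul_assoc, hG, mul_assoc]
  | inv G hG =>
    have h := hG (ract g G⁻¹)
    rw [← ract_mul, inv_mul_cancel, ract_one] at h
    rw [map_inv (eps _), map_inv (As.map _), toAdd_inv, zpow_neg, inv_mul_eq_iff_eq_mul, ← mul_assoc, h]
    group

theorem ract_coe_of_eps_eq_one (g : Cover X a) {G : As (Cover X a)} (hG : eps _ G = 1) :
    (ract g G).1 = g.1 * As.map (proj a) G := by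
  simpa [hG] using ract_coe g G

theorem proj_surjective (hX : IsConnected X) : Function.Surjective (proj a) := by
  intro x
  obtain ⟨g, hg, h⟩ := hX.exists_ract_eq a x
  exact ⟨⟨g, h⟩, hg⟩

theorem map_proj_surjective (hX : IsConnected X) :
    Function.Surjective (As.map (proj a)) := by
  intro g
  induction g using As.induction with
  | gen x =>
    obtain ⟨g, rfl⟩ := proj_surjective (a := a) hX x
    exact ⟨e g, As.map_e _ _⟩
  | one => exact ⟨1, map_one _⟩
  | mul g h hg hh =>
    obtain ⟨G, rfl⟩ := hg
    obtain ⟨H, rfl⟩ := hh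
    exact ⟨G * H, map_mul _ _ _⟩
  | inv g hg =>
    obtain ⟨G, rfl⟩ := hg
    exact ⟨G⁻¹, map_inv _ _⟩

/-- A lift `G` of `g⁻¹h` along `p_*` has degree zero, so it carries `g` to `g · p_*(G) = h`. -/
theorem isConnected (hX : IsConnected X) : IsConnected (Cover X a) := by
  refine ⟨⟨⟨1, one_mem _⟩⟩, fun g h => ?_⟩
  obtain ⟨G, hG⟩ := map_proj_surjective (a := a) hX (g.1⁻¹ * h.1)
  have hε : eps _ G = 1 := by
    rw [← eps_map_proj, hG, map_mul, map_inv, eps_coe, eps_coe, inv_one, one_mul]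
  exact ⟨G, ext (by rw [ract_coe_of_eps_eq_one g hε, hG, mul_inv_cancel_left])⟩

theorem reducedStabilizer_eq_ker (g : Cover X a) :
    reducedStabilizer g = (As.map (proj a)).ker := by
  ext G
  rw [mem_reducedStabilizer, MonoidHom.mem_ker]
  constructor
  · rintro ⟨h1, h2⟩
    have h := ract_coe_of_eps_eq_one g h2
    rwa [h1, left_eq_mul] at h
  · intro h
    have hε : eps _ G = 1 := by rw [← eps_map_proj, h, map_one]
    exact ⟨ext (by rw [ract_coe_of_eps_eq_one g hε, h, mul_one]), hε⟩

/-- The kernel is the reduced stabilizer of every point at once, so it acts trivially. -/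
theorem ker_map_proj_le_center : (As.map (proj a)).ker ≤ Subgroup.center (As (Cover X a)) := by
  intro G hG
  refine As.mem_center fun g => ?_
  rw [← reducedStabilizer_eq_ker g] at hG
  exact hG.1

end Cover

/-! ### Finite type and the torsion bound. -/

theorem e_pow_mem_center {t : ℕ} (ht : ∀ x y : X, (fun z => z ⊲ y)^[t] x = x) (y : X) :
    e y ^ t ∈ Subgroup.center (As X) :=
  As.mem_center fun x => by rw [ract_pow, ht]

theorem IsConnected.e_pow_eq (hX : IsConnected X) {t : ℕ}
    (ht : ∀ x y : X, (fun z => z ⊲ y)^[t] x = x) (x y : X) : e x ^ t = e y ^ t := by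
  obtain ⟨g, rfl⟩ := hX.2 x y
  have h := Subgroup.mem_center_iff.mp (e_pow_mem_center ht x) g⁻¹
  have h2 := conj_pow (i := t) (a := g⁻¹) (b := e x)
  rw [inv_inv] at h2
  rw [e_ract, h2, h, inv_mul_cancel_right]

/-- The universal covering inherits the identity `x ⊲^t y = x`. -/
theorem Cover.iterate_rop (hX : IsConnected X) {t : ℕ}
    (ht : ∀ x y : X, (fun z => z ⊲ y)^[t] x = x) (g h : Cover X a) :
    (fun z => z ⊲ h)^[t] g = g := by
  rw [← ract_pow]
  -- The formula reads `e_a ^ t (g · e_h ^ t) = g e_{p(h)} ^ t`, and `e_{p(h)} ^ t = e_a ^ t` is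
  -- central.
  have h1 := ract_coe g (e h ^ t)
  rw [map_pow (eps _), map_pow (As.map _), As.map_e, hX.e_pow_eq ht _ a,
    Subgroup.mem_center_iff.mp (e_pow_mem_center ht a), NosakaQuandle.eps_e, ← ofAdd_nsmul] at h1
  exact Cover.ext (by simpa using h1)

/-- The central elements whose `t`-th power is trivial. -/
def centralTorsion (G : Type u) [Group G] (t : ℕ) : Subgroup G where
  carrier := {k | k ∈ Subgroup.center G ∧ k ^ t = 1}
  one_mem' := ⟨one_mem _, one_pow _⟩
  mul_mem' := fun {k l} hk hl => ⟨mul_mem hk.1 hl.1, by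
    rw [Commute.mul_pow (Subgroup.mem_center_iff.mp hl.1 k), hk.2, hl.2, mul_one]⟩
  inv_mem' := fun {k} hk => ⟨inv_mem hk.1, by rw [inv_pow, hk.2, inv_one]⟩

instance (G : Type u) [Group G] (t : ℕ) : (centralTorsion G t).Normal :=
  ⟨fun k hk g => by rwa [Subgroup.mem_center_iff.mp hk.1 g, mul_inv_cancel_right]⟩

/-- Modulo the `t`-torsion of the center, `e_g` only depends on `p(g)`, so that `p_*` has a
left inverse there. -/
theorem Cover.ker_map_proj_le_centralTorsion (hX : IsConnected X) {t : ℕ}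
    (ht : ∀ x y : X, (fun z => z ⊲ y)^[t] x = x) :
    (As.map (proj a)).ker ≤ centralTorsion (As (Cover X a)) t := by
  have hs := Function.rightInverse_surjInv (proj_surjective (a := a) hX)
  set s := Function.surjInv (proj_surjective (a := a) hX)
  let π := QuotientGroup.mk' (centralTorsion (As (Cover X a)) t)
  have hπ : ∀ g h : Cover X a, proj a g = proj a h → π (e g) = π (e h) := by
    intro g h hgh
    have hk : (e g)⁻¹ * e h ∈ (As.map (proj a)).ker := by
      rw [MonoidHom.mem_ker, map_mul, map_inv, As.map_e, As.map_e, hgh, inv_mul_cancel]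
    have hc := ker_map_proj_le_center hk
    refine QuotientGroup.eq.mpr ⟨hc, ?_⟩
    -- With `k = e_g⁻¹ e_h` central, `e_h ^ t = e_g ^ t k ^ t`; equal `t`-th powers force `k ^ t =
    -- 1`.
    have h2 := Commute.mul_pow (Subgroup.mem_center_iff.mp hc (e g)) t
    rw [mul_inv_cancel_left, (isConnected hX).e_pow_eq (iterate_rop hX ht) h g] at h2
    exact (left_eq_mul.mp h2)
  -- The choice of section `s` is harmless: by `hπ` the class of `e_{s(x)}` depends only on `x`.
  let r : As X →* As (Cover X a) ⧸ centralTorsion (As (Cover X a)) t :=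
    As.lift (fun x => π (e (s x))) fun x y => by
      rw [← map_inv, ← map_mul, ← map_mul, ← e_rop]
      apply hπ
      rw [hs]
      change x ⊲ y = proj a (Shelf.act (s y) (s x))
      rw [ShelfHom.map_act, hs, hs]
      rfl
  have hr : r.comp (As.map (proj a)) = π := As.hom_ext fun g => by
    rw [MonoidHom.comp_apply, As.map_e, As.lift_e]
    exact hπ _ _ (hs _)
  intro k hk
  rw [← QuotientGroup.eq_one_iff]
  change π k = 1
  rw [← hr, MonoidHom.comp_apply, hk, map_one]

/-- A choice of elements of `Ker ε` carrying `1` to the elements of the universal covering. -/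
noncomputable def Cover.spanning (hX : IsConnected X) (a : X) : Spanning (Cover X a) where
  base := ⟨1, one_mem _⟩
  path g := ((isConnected hX).exists_ract_eq _ g).choose
  ract_path g := ((isConnected hX).exists_ract_eq _ g).choose_spec.1
  eps_path g := ((isConnected hX).exists_ract_eq _ g).choose_spec.2
  le_center := (reducedStabilizer_eq_ker _).trans_le ker_map_proj_le_center

/-- The isomorphism between the second quandle homology of the universal covering and the
kernel of `p_*`. -/
noncomputable def Cover.homologyEquiv (hX : IsConnected X) (a : X) :
    Multiplicative (QuandleHomology (Cover X a) 2) ≃* (As.map (proj a)).ker :=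
  (MonoidHom.ofInjective (spanning hX a).homologyHom_injective).trans
    (MulEquiv.subgroupCongr ((spanning hX a).range_homologyHom.trans (reducedStabilizer_eq_ker _)))

end Cover

end NosakaQuandle

theorem theorem5p4 {X : Type*} [Quandle X] (hX : NosakaQuandle.IsConnected X) (a : X) :
    Nonempty
      (Multiplicative (NosakaQuandle.QuandleHomology (NosakaQuandle.Cover X a) 2) ≃*
        (NosakaQuandle.As.map (NosakaQuandle.Cover.proj a)).ker) ∧
    ∀ t : ℕ, NosakaQuandle.IsType X t →
      ∀ c : NosakaQuandle.QuandleHomology (NosakaQuandle.Cover X a) 2, t • c = 0 := by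
  refine ⟨⟨NosakaQuandle.Cover.homologyEquiv hX a⟩, fun t ht c => ?_⟩
  have h := NosakaQuandle.Cover.ker_map_proj_le_centralTorsion hX ht.1.2
    (NosakaQuandle.Cover.homologyEquiv hX a (Multiplicative.ofAdd c)).2
  have h2 : NosakaQuandle.Cover.homologyEquiv hX a (Multiplicative.ofAdd c ^ t) = 1 := by
    rw [map_pow]
    exact Subtype.ext h.2
  rw [map_eq_one_iff _ (MulEquiv.injective _)] at h2
  exact Multiplicative.ofAdd.injective h2
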